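/- Let $A=\{0,1,2,3,E\}$, let $\sigma$ be the shift on $A^{\mathbb Z}$, $(\sigma x)_i=x_{i+1}$, and let $F=F_d\circ F_p$ be the following cellular automaton on $A^{\mathbb Z}$. The map $F_p$ replaces by $0$ every letter $x_i=E$ for which $x_{i+j}=E$ for some $j$ with $1\le |j|\le 3$, and changes nothing else. The map $F_d$ keeps every letter $E$, and replaces a letter $x_i\ne E$ by $$x_i-2\cdot\mathbf 1_{\{2,3\}}(x_i)+\mathbf 1_{\{2,3\}}(x_{i-1})+\mathbf 1_{\{E\}}(x_{i-1})\bigl(1+\mathbf 1_{\{2\}}(x_{i-2})\bigr).$$ Let $0<\nu<1$ (for instance $\nu=2/3$), let $\nu_*$ be the geometric law of parameter $\nu$ conditioned to be at least $3$, that is $\nu_*(k)=\nu^k/\sum_{j\ge 3}\nu^j$ for $k\ge 3$ and $\nu_*(k)=0$ for $k<3$, and let $\bar l=\sum_k k\,\nu_*(k)$. For $l,c\in\mathbb N^{\mathbb Z}$ with $l_i\ge 3$ and $0\le c_i<2^{l_i}$, let $w(l,c)\in\{0,1,E\}^{\mathbb Z}$ be the configuration whose letters $E$ stand exactly at the positions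 $s_j$, $j\in\mathbb Z$, given by $s_0=0$ and $s_{j+1}-s_j=l_j+1$, and in which the $l_j$ letters between $s_j$ and $s_{j+1}$ are the binary digits of $c_j$, least significant digit first. Let $\tilde\mu^F$ be the probability measure $$\tilde\mu^F(I)=\frac1{\bar l+1}\int_{\mathbb N^{\mathbb Z}}\ \sum_{k=0}^{l_0} m_l\bigl(\{c:\sigma^k w(l,c)\in I\}\bigr)\ \nu_*^{\otimes\mathbb Z}(dl),$$ where, under $m_l$, the $c_i$ are independent and $c_i$ is uniform on $\{0,\dots,2^{l_i}-1\}$. Let $\mu^F$ be any weak limit of the Cesàro means $\frac1n\sum_{k=0}^{n-1}\tilde\mu^F\circ F^{-k}$ along a subsequence $n\to\infty$. Then such measures $\mu^F$ exist, and every such $\mu^F$ is $\sigma$-invariant and $F$-invariant, and its entropy with respect to the shift is strictly positive: $$h_{\mu^F}(\sigma)>0 .$$ Moreover, if $\nu^3\le 1-\nu$ (in particular if $\nu=2/3$), then $$h_{\mu^F}(\sigma)\ \ge\ \tfrac14\,\log\frac1{1-\nu}.$$ -/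

import Mathlib

open MeasureTheory ProbabilityTheory Filter Topology Finset

noncomputable section

/-! ### Metric entropy -/

/-- The entropy `-∑ μ(A) log μ(A)` of the finite partition into the fibres of `α`. -/
def partitionEntropy {X ι : Type*} [MeasurableSpace X] [Fintype ι] (μ : Measure X)
    (α : X → ι) : ℝ :=
  ∑ a, Real.negMulLog (μ.real (α ⁻¹' {a}))

/-- The fibres of `itinerary T α n` are the atoms of `α ∨ T⁻¹α ∨ ⋯ ∨ T⁻⁽ⁿ⁻¹⁾α`. -/
def itinerary {X ι : Type*} (T : X → X) (α : X → ι) (n : ℕ) : X → (Fin n → ι) :=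
  fun x i => α (T^[i] x)

/-- `h_μ(T, α)`. The limit exists when `T` preserves `μ`; it is written as a lower limit. -/
def entropyOfPartition {X ι : Type*} [MeasurableSpace X] [Fintype ι] (T : X → X)
    (μ : Measure X) (α : X → ι) : EReal :=
  liminf (fun n : ℕ => ((partitionEntropy μ (itinerary T α n) / n : ℝ) : EReal)) atTop

/-- The metric entropy `h_μ(T)`: the supremum of `h_μ(T, α)` over finite measurable partitions. -/
def metricEntropy {X : Type*} [MeasurableSpace X] (T : X → X) (μ : Measure X) : EReal :=
  ⨆ (k : ℕ) (α : X → Fin k) (_ : Measurable α), entropyOfPartition T μ α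

/-! ### The cellular automaton -/

/-- The alphabet `{0, 1, 2, 3, E}`; the letter `E` is `4`. -/
abbrev Letter : Type := Fin 5

/-- The emitter `E`. -/
abbrev emitter : Letter := 4

/-- The configuration space, with the product topology and σ-algebra. -/
abbrev Config : Type := ℤ → Letter

/-- The shift `σ`. -/
def shift (x : Config) : Config := fun i => x (i + 1)

/-- The local rule `f_d`, applied to `x_{i-2} x_{i-1} x_i`. -/
def localRuleD (a b c : Letter) : Letter :=
  if c = emitter then emitter
  else
    Fin.ofNat 5 ((c : ℕ) - (if c = 2 ∨ c = 3 then 2 else 0) + (if b = 2 ∨ b = 3 then 1 else 0)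
      + (if b = emitter then 1 + (if a = 2 then 1 else 0) else 0))

/-- The main automaton `F_d`. -/
def autD (x : Config) : Config := fun i => localRuleD (x (i - 2)) (x (i - 1)) (x i)

/-- The local rule `f_p`, applied to `x_{i-3} … x_{i+3}`: a letter `E` with another `E` at distance
at most `3` becomes `0`. -/
def localRuleP (a b c d e f g : Letter) : Letter :=
  if d = emitter ∧ (a = emitter ∨ b = emitter ∨ c = emitter ∨
      e = emitter ∨ f = emitter ∨ g = emitter) then 0
  else d

/-- The projection `F_p`. -/
def autP (x : Config) : Config := fun i =>
  localRuleP (x (i - 3)) (x (i - 2)) (x (i - 1)) (x i) (x (i + 1)) (x (i + 2)) (x (i + 3))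

/-- The automaton `F = F_d ∘ F_p`. -/
def aut (x : Config) : Config := autD (autP x)

lemma measurable_shift : Measurable shift :=
  measurable_pi_lambda _ fun i => measurable_pi_apply (i + 1)

lemma measurable_aut : Measurable aut := by
  have hc (i : ℤ) : Measurable fun x : Config => x i := measurable_pi_apply i
  have hP : Measurable autP := measurable_pi_lambda _ fun i =>
    (measurable_of_countable
      (fun p : Letter × Letter × Letter × Letter × Letter × Letter × Letter =>
        localRuleP p.1 p.2.1 p.2.2.1 p.2.2.2.1 p.2.2.2.2.1 p.2.2.2.2.2.1 p.2.2.2.2.2.2)).comp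
      ((hc (i - 3)).prodMk ((hc (i - 2)).prodMk ((hc (i - 1)).prodMk ((hc i).prodMk
        ((hc (i + 1)).prodMk ((hc (i + 2)).prodMk (hc (i + 3))))))))
  have hD : Measurable autD := measurable_pi_lambda _ fun i =>
    (measurable_of_countable
      (fun p : Letter × Letter × Letter => localRuleD p.1 p.2.1 p.2.2)).comp
      ((hc (i - 2)).prodMk ((hc (i - 1)).prodMk (hc i)))
  exact hD.comp hP

/-! ### The laws of the lengths and of the states of the counters -/

/-- The weights `ν^k`, `k ≥ 3`, of the conditioned geometric law. -/
def lengthWeight (ν : ℝ) (k : ℕ) : ENNReal := if 3 ≤ k then ENNReal.ofReal (ν ^ k) else 0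

lemma tsum_lengthWeight_ne_zero {ν : ℝ} (hν : ν ∈ Set.Ioo (0 : ℝ) 1) :
    ∑' k, lengthWeight ν k ≠ 0 := by
  intro h
  have h3 := ENNReal.tsum_eq_zero.1 h 3
  simp only [lengthWeight, le_refl, if_true, ENNReal.ofReal_eq_zero] at h3
  exact absurd (pow_pos hν.1 3) (not_lt.2 h3)

lemma tsum_lengthWeight_ne_top {ν : ℝ} (hν : ν ∈ Set.Ioo (0 : ℝ) 1) :
    ∑' k, lengthWeight ν k ≠ ⊤ := by
  refine ne_top_of_le_ne_top
    (summable_geometric_of_lt_one hν.1.le hν.2).tsum_ofReal_ne_top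
    (ENNReal.tsum_le_tsum fun k => ?_)
  unfold lengthWeight
  split_ifs <;> simp

/-- `ν_*`: the geometric law of parameter `ν` conditioned to be at least `3`, that is
`ν_*(k) = ν^k / ∑_{j > 2} ν^j` for `k ≥ 3`. -/
def lengthLaw (ν : ℝ) (hν : ν ∈ Set.Ioo (0 : ℝ) 1) : PMF ℕ :=
  PMF.normalize (lengthWeight ν) (tsum_lengthWeight_ne_zero hν) (tsum_lengthWeight_ne_top hν)

/-- The product measure `ν_*^{⊗ ℤ}` on sequences of lengths. -/
def lengthSeqLaw (ν : ℝ) (hν : ν ∈ Set.Ioo (0 : ℝ) 1) : Measure (ℤ → ℕ) :=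
  Measure.infinitePi fun _ : ℤ => (lengthLaw ν hν).toMeasure

instance isProbabilityMeasure_lengthSeqLaw (ν : ℝ) (hν : ν ∈ Set.Ioo (0 : ℝ) 1) :
    IsProbabilityMeasure (lengthSeqLaw ν hν) := by
  unfold lengthSeqLaw; infer_instance

/-- The mean length `∑ ν_*(k) k`. -/
def meanLength (ν : ℝ) (hν : ν ∈ Set.Ioo (0 : ℝ) 1) : ENNReal :=
  ∑' k, lengthLaw ν hν k * k

lemma meanLength_ne_top {ν : ℝ} (hν : ν ∈ Set.Ioo (0 : ℝ) 1) : meanLength ν hν ≠ ⊤ := by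
  have hs : Summable fun k : ℕ => (k : ℝ) * ν ^ k := by
    have := summable_pow_mul_geometric_of_norm_lt_one (R := ℝ) 1 (r := ν)
      (by rw [Real.norm_eq_abs, abs_of_pos hν.1]; exact hν.2)
    simpa using this
  have h1 : ∑' k, lengthWeight ν k * k ≠ ⊤ := by
    refine ne_top_of_le_ne_top hs.tsum_ofReal_ne_top (ENNReal.tsum_le_tsum fun k => ?_)
    rw [ENNReal.ofReal_mul (Nat.cast_nonneg k), ENNReal.ofReal_natCast, mul_comm]
    unfold lengthWeight
    split_ifs <;> simp
  have h2 : meanLength ν hν = (∑' k, lengthWeight ν k * k) * (∑' k, lengthWeight ν k)⁻¹ := by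
    rw [← ENNReal.tsum_mul_right]
    refine tsum_congr fun k => ?_
    simp only [lengthLaw, PMF.normalize_apply]
    ring
  rw [h2]
  exact ENNReal.mul_ne_top h1 (ENNReal.inv_ne_top.2 (tsum_lengthWeight_ne_zero hν))

/-- The uniform law on `{0, …, 2^L - 1}`. -/
def uniformState (L : ℕ) : PMF ℕ :=
  PMF.uniformOfFinset (Finset.range (2 ^ L)) (Finset.nonempty_range_iff.2 (by positivity))

/-- `m_l`: the states of the counters are independent, the `i`-th one being uniform on
`{0, …, 2^{l_i} - 1}`. -/
def stateLaw (l : ℤ → ℕ) : Measure (ℤ → ℕ) :=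
  Measure.infinitePi fun i : ℤ => (uniformState (l i)).toMeasure

instance isProbabilityMeasure_stateLaw (l : ℤ → ℕ) : IsProbabilityMeasure (stateLaw l) := by
  unfold stateLaw; infer_instance

lemma measurable_stateLaw : Measurable stateLaw := by
  refine Measurable.measure_of_isPiSystem_of_isProbabilityMeasure
    (S := squareCylinders fun _ : ℤ => {s : Set ℕ | MeasurableSet s})
    generateFrom_squareCylinders.symm
    (isPiSystem_squareCylinders (fun _ => MeasurableSpace.isPiSystem_measurableSet)
      (fun _ => by simp)) ?_
  rintro _ ⟨s, t, ht, rfl⟩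
  have ht' : ∀ i ∈ s, MeasurableSet (t i) := fun i _ => ht i (Set.mem_univ i)
  have : (fun l => stateLaw l ((s : Set ℤ).pi t))
      = fun l => ∏ i ∈ s, (uniformState (l i)).toMeasure (t i) := by
    funext l
    exact Measure.infinitePi_pi _ ht'
  rw [this]
  exact Finset.measurable_prod _ fun i _ =>
    (measurable_of_countable fun L => (uniformState L).toMeasure (t i)).comp
      (measurable_pi_apply i)

/-! ### From counters to configurations -/

/-- The position `s_j` of the `j`-th emitter when `s_0 = 0` and `s_{j+1} - s_j - 1 = l_j`. -/
def emitterPos (l : ℤ → ℕ) (j : ℤ) : ℤ :=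
  ∑ i ∈ Finset.Ico 0 j, ((l i : ℤ) + 1) - ∑ i ∈ Finset.Ico j 0, ((l i : ℤ) + 1)

/-- The configuration with letters in `{0, 1, E}` and `x_0 = E` whose counters are `(l_i, c_i, 0)`:
the emitters stand at the positions `s_j`, and between `s_j` and `s_{j+1}` stand the binary digits
of `c_j`, the least significant one on the left. -/
def writeCounters (l c : ℤ → ℕ) : Config := fun p =>
  open Classical in
  if ∃ j, p = emitterPos l j then emitter
  else if ∃ j, emitterPos l j < p ∧ p < emitterPos l (j + 1) ∧
      (c j).testBit (p - emitterPos l j - 1).toNat = true then 1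
  else 0

lemma measurable_emitterPos (j : ℤ) : Measurable fun l : ℤ → ℕ => emitterPos l j := by
  have h (i : ℤ) : Measurable fun l : ℤ → ℕ => ((l i : ℤ) + 1) :=
    (measurable_of_countable fun n : ℕ => ((n : ℤ) + 1)).comp (measurable_pi_apply i)
  exact (Finset.measurable_sum _ fun i _ => h i).sub (Finset.measurable_sum _ fun i _ => h i)

lemma measurable_writeCounters :
    Measurable fun q : (ℤ → ℕ) × (ℤ → ℕ) => writeCounters q.1 q.2 := by
  classical
  refine measurable_pi_lambda _ fun p => ?_
  have hs (j : ℤ) : Measurable fun q : (ℤ → ℕ) × (ℤ → ℕ) => emitterPos q.1 j :=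
    (measurable_emitterPos j).comp measurable_fst
  have hc (j : ℤ) : Measurable fun q : (ℤ → ℕ) × (ℤ → ℕ) => q.2 j :=
    (measurable_pi_apply j).comp measurable_snd
  unfold writeCounters
  refine Measurable.ite ?_ measurable_const (Measurable.ite ?_ measurable_const measurable_const)
  · rw [Set.ofPred_exists]
    exact MeasurableSet.iUnion fun j => measurableSet_eq_fun measurable_const (hs j)
  · rw [Set.ofPred_exists]
    refine MeasurableSet.iUnion fun j => ?_
    have hm : Measurable fun q : (ℤ → ℕ) × (ℤ → ℕ) =>
        (emitterPos q.1 j, emitterPos q.1 (j + 1), q.2 j) :=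
      (hs j).prodMk ((hs (j + 1)).prodMk (hc j))
    exact hm (Set.to_countable {r : ℤ × ℤ × ℕ | r.1 < p ∧ p < r.2.1 ∧
      r.2.2.testBit (p - r.1 - 1).toNat = true}).measurableSet

/-! ### The invariant measure -/

/-- The measure of mass `l_0 + 1` which gives, for given lengths, mass `1` to each of the `l_0 + 1`
positions of the origin in `{s_0, …, s_1 - 1}`. -/
def fibreMeasure (l : ℤ → ℕ) : Measure Config :=
  ∑ k ∈ Finset.range (l 0 + 1), (stateLaw l).map fun c => shift^[k] (writeCounters l c)

lemma fibreMeasure_apply (l : ℤ → ℕ) {s : Set Config} (hs : MeasurableSet s) :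
    fibreMeasure l s = ∑ k ∈ Finset.range (l 0 + 1),
      stateLaw l {c | shift^[k] (writeCounters l c) ∈ s} := by
  rw [fibreMeasure, Measure.finsetSum_apply]
  refine Finset.sum_congr rfl fun k _ => ?_
  rw [Measure.map_apply _ hs]
  · rfl
  · exact (measurable_shift.iterate k).comp
      (measurable_writeCounters.comp (measurable_const.prodMk measurable_id))

lemma measurable_stateLaw_section {S : Set ((ℤ → ℕ) × (ℤ → ℕ))} (hS : MeasurableSet S) :
    Measurable fun l => stateLaw l (Prod.mk l ⁻¹' S) := by
  let κ : Kernel (ℤ → ℕ) (ℤ → ℕ) := ⟨stateLaw, measurable_stateLaw⟩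
  have hκ : IsMarkovKernel κ := ⟨fun l => inferInstanceAs (IsProbabilityMeasure (stateLaw l))⟩
  exact Kernel.measurable_kernel_prodMk_left (κ := κ) hS

lemma measurable_sum_range (f : ℕ → (ℤ → ℕ) → ENNReal) (hf : ∀ k, Measurable (f k)) :
    Measurable fun l : ℤ → ℕ => ∑ k ∈ Finset.range (l 0 + 1), f k l := by
  have hn : Measurable fun q : (ℤ → ℕ) × ℕ => ∑ k ∈ Finset.range (q.2 + 1), f k q.1 :=
    measurable_from_prod_countable_left fun n =>
      Finset.measurable_sum (Finset.range (n + 1)) fun k _ => hf k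
  exact hn.comp (measurable_id.prodMk (measurable_pi_apply 0))

lemma measurable_fibreMeasure : Measurable fibreMeasure := by
  refine Measure.measurable_of_measurable_coe _ fun s hs => ?_
  have h : (fun l => fibreMeasure l s) = fun l => ∑ k ∈ Finset.range (l 0 + 1),
      stateLaw l {c | shift^[k] (writeCounters l c) ∈ s} :=
    funext fun l => fibreMeasure_apply l hs
  rw [h]
  exact measurable_sum_range _ fun k => measurable_stateLaw_section
    (((measurable_shift.iterate k).comp measurable_writeCounters) hs)

/-- The initial measure `μ̃^F`: the average of `fibreMeasure l` over the lengths, normalized. -/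
def initialMeasure (ν : ℝ) (hν : ν ∈ Set.Ioo (0 : ℝ) 1) : Measure Config :=
  (meanLength ν hν + 1)⁻¹ • (lengthSeqLaw ν hν).bind fibreMeasure

instance isProbabilityMeasure_initialMeasure (ν : ℝ) (hν : ν ∈ Set.Ioo (0 : ℝ) 1) :
    IsProbabilityMeasure (initialMeasure ν hν) := by
  constructor
  have h1 : (lengthSeqLaw ν hν).bind fibreMeasure Set.univ = meanLength ν hν + 1 := by
    rw [Measure.bind_apply MeasurableSet.univ measurable_fibreMeasure.aemeasurable]
    have h2 (l : ℤ → ℕ) : fibreMeasure l Set.univ = (l 0 : ENNReal) + 1 := by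
      rw [fibreMeasure_apply l MeasurableSet.univ]
      simp
    simp_rw [h2]
    rw [lintegral_add_right _ measurable_const]
    congr 1
    · have h3 := (measurePreserving_eval_infinitePi
        (fun _ : ℤ => (lengthLaw ν hν).toMeasure) 0).lintegral_comp
          (f := fun n : ℕ => (n : ENNReal)) (measurable_of_countable _)
      refine h3.trans ?_
      rw [lintegral_countable']
      refine tsum_congr fun k => ?_
      rw [PMF.toMeasure_apply_singleton _ _ (measurableSet_singleton k), mul_comm]
    · simp
  rw [initialMeasure, Measure.smul_apply, h1, smul_eq_mul]
  exact ENNReal.inv_mul_cancel (by simp) (by simp [meanLength_ne_top hν])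

/-- The Cesàro mean `(1/(n+1)) ∑_{k=0}^{n} μ̃^F ∘ F^{-k}`. -/
def cesaroMeasure (ν : ℝ) (hν : ν ∈ Set.Ioo (0 : ℝ) 1) (n : ℕ) : Measure Config :=
  ((n : ENNReal) + 1)⁻¹ • ∑ k ∈ Finset.range (n + 1), (initialMeasure ν hν).map aut^[k]

instance isProbabilityMeasure_cesaroMeasure (ν : ℝ) (hν : ν ∈ Set.Ioo (0 : ℝ) 1) (n : ℕ) :
    IsProbabilityMeasure (cesaroMeasure ν hν n) := by
  constructor
  have h (k : ℕ) : (initialMeasure ν hν).map aut^[k] Set.univ = 1 := by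
    rw [Measure.map_apply (measurable_aut.iterate k) MeasurableSet.univ, Set.preimage_univ,
      measure_univ]
  rw [cesaroMeasure, Measure.smul_apply, Measure.finsetSum_apply]
  simp_rw [h]
  simp only [Finset.sum_const, Finset.card_range, nsmul_eq_mul, mul_one, smul_eq_mul]
  push_cast
  exact ENNReal.inv_mul_cancel (by simp) (by simp)

/-- The Cesàro mean as a point of the space of probability measures (weak topology). -/
def cesaroMean (ν : ℝ) (hν : ν ∈ Set.Ioo (0 : ℝ) 1) (n : ℕ) : ProbabilityMeasure Config :=
  ⟨cesaroMeasure ν hν n, inferInstance⟩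

/-- `μ` is a measure `μ^F`: a weak limit of the Cesàro means along some subsequence. -/
def IsLimitMeasure (ν : ℝ) (hν : ν ∈ Set.Ioo (0 : ℝ) 1) (μ : ProbabilityMeasure Config) : Prop :=
  ∃ n : ℕ → ℕ, StrictMono n ∧ Tendsto (fun j => cesaroMean ν hν (n j)) atTop (𝓝 μ)

end

/-!
The counters play no role in the bound: the entropy is already carried by the positions of the
emitters.

*Invariance.* Summing over the `l_0 + 1` positions of the origin inside the counter `0` makes the
initial measure shift invariant: shifting replaces the term of the origin at `s_0` by that of the
origin at `s_1`, and the law of the counters is the same seen from either of them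
(`map_shift_initialMeasure`). The Cesàro means inherit this, since the automaton commutes with the
shift, and weak limits keep it, since the shift is continuous. The invariance under the automaton is
the argument of Krylov and Bogolyubov, and limits exist because the space of probability measures on
a compact metrizable space is compact and metrizable.

*The emitters do not move.* Almost surely all lengths are at least `3`, so any two emitters are at
distance at least `4`; on such configurations the projection does nothing and the automaton keeps
the set of emitters (`aut_iterate_eq_emitter_iff`). As the events which only involve finitely many
emitters are clopen, they have the same probability under every limit measure as under the initial
measure (`IsLimitMeasure.apply_emitters`).

*Entropy.* The set of emitters is thus a stationary renewal process whose gaps have law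
`(1 - ν) ν^(g - 4)`, `g ≥ 4`. A given pattern with `m` emitters in a window of length `n` has
probability at most `C ν^(n - 4m) (1 - ν)^m` (`initialMeasure_pattern_le`), and the mean of `m` is
`n (1 - ν) / (4 - 3ν)`, by shift invariance and `initialMeasure_emitter`. Taking the mean of minus
the logarithm of this bound gives, up to a constant, a lower bound for the entropy of the window,
whence `h_μ(σ) ≥ (-ν log ν - (1 - ν) log (1 - ν)) / (4 - 3ν) > 0`
(`IsLimitMeasure.le_metricEntropy`). This is at least `log (1 / (1 - ν)) / 4` exactly when
`ν ^ 4 ≤ 1 - ν`.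
-/

/-! ### The automaton and the shift -/

lemma continuous_shift : Continuous shift :=
  continuous_pi fun i => continuous_apply (i + 1)

lemma continuous_aut : Continuous aut := by
  have hP : Continuous autP := continuous_pi fun i =>
    (continuous_of_discreteTopology
      (f := fun p : Letter × Letter × Letter × Letter × Letter × Letter × Letter =>
        localRuleP p.1 p.2.1 p.2.2.1 p.2.2.2.1 p.2.2.2.2.1 p.2.2.2.2.2.1 p.2.2.2.2.2.2)).comp
      (f := fun x : Config => (x (i - 3), x (i - 2), x (i - 1), x i, x (i + 1), x (i + 2),
        x (i + 3))) (by fun_prop)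
  have hD : Continuous autD := continuous_pi fun i =>
    (continuous_of_discreteTopology
      (f := fun p : Letter × Letter × Letter => localRuleD p.1 p.2.1 p.2.2)).comp
      (f := fun x : Config => (x (i - 2), x (i - 1), x i)) (by fun_prop)
  exact hD.comp hP

lemma shift_aut (x : Config) : shift (aut x) = aut (shift x) := by
  funext i
  simp only [shift, aut, autD, autP]
  congr 2 <;> ring_nf

lemma shift_iterate_apply (k : ℕ) (x : Config) (i : ℤ) : shift^[k] x i = x (i + k) := by
  induction k generalizing i with
  | zero => simp
  | succ k ih =>
    rw [Function.iterate_succ_apply', shift, ih]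
    congr 1
    push_cast
    ring

/-- Two emitters of the configuration are never at distance at most `3`. -/
def EmittersSpaced (x : Config) : Prop :=
  ∀ i, x i = emitter → ∀ j, x j = emitter → i < j → i + 4 ≤ j

lemma autP_of_emittersSpaced {x : Config} (hx : EmittersSpaced x) : autP x = x := by
  funext i
  unfold autP localRuleP
  rw [if_neg]
  rintro ⟨hi, h | h | h | h | h | h⟩
  · have := hx _ h _ hi (by omega)
    omega
  · have := hx _ h _ hi (by omega)
    omega
  · have := hx _ h _ hi (by omega)
    omega
  · have := hx _ hi _ h (by omega)
    omega
  · have := hx _ hi _ h (by omega)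
    omega
  · have := hx _ hi _ h (by omega)
    omega

lemma localRuleD_eq_emitter_iff (a b c : Letter) : localRuleD a b c = emitter ↔ c = emitter := by
  revert a b c
  decide

lemma aut_eq_emitter_iff {x : Config} (hx : EmittersSpaced x) (i : ℤ) :
    aut x i = emitter ↔ x i = emitter := by
  rw [aut, autP_of_emittersSpaced hx]
  exact localRuleD_eq_emitter_iff _ _ _

lemma emittersSpaced_aut {x : Config} (hx : EmittersSpaced x) : EmittersSpaced (aut x) := by
  intro i hi j hj
  exact hx i ((aut_eq_emitter_iff hx i).1 hi) j ((aut_eq_emitter_iff hx j).1 hj)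

/-- The automaton does not move emitters which are at distance at least `4` from each other. -/
lemma aut_iterate_eq_emitter_iff {x : Config} (hx : EmittersSpaced x) (k : ℕ) (i : ℤ) :
    aut^[k] x i = emitter ↔ x i = emitter := by
  induction k generalizing x with
  | zero => rfl
  | succ k ih =>
    rw [Function.iterate_succ_apply, ih (emittersSpaced_aut hx), aut_eq_emitter_iff hx]

lemma exists_isLimitMeasure (ν : ℝ) (hν : ν ∈ Set.Ioo (0 : ℝ) 1) :
    ∃ μ : ProbabilityMeasure Config, IsLimitMeasure ν hν μ := by
  obtain ⟨μ, φ, hφ, h⟩ := CompactSpace.tendsto_subseq (cesaroMean ν hν)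
  exact ⟨μ, φ, hφ, h⟩

/-! ### Positions of the emitters -/

lemma emitterPos_zero (l : ℤ → ℕ) : emitterPos l 0 = 0 := by
  simp [emitterPos]

lemma emitterPos_add_one (l : ℤ → ℕ) (j : ℤ) :
    emitterPos l (j + 1) = emitterPos l j + l j + 1 := by
  unfold emitterPos
  rcases le_or_gt 0 j with h | h
  · have h1 : Finset.Ico 0 (j + 1) = insert j (Finset.Ico 0 j) := by
      ext i
      simp only [Finset.mem_Ico, Finset.mem_insert]
      omega
    rw [h1, Finset.sum_insert (by simp), Finset.Ico_eq_empty (a := j) (by omega),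
      Finset.Ico_eq_empty (a := j + 1) (by omega)]
    ring
  · have h1 : Finset.Ico j 0 = insert j (Finset.Ico (j + 1) 0) := by
      ext i
      simp only [Finset.mem_Ico, Finset.mem_insert]
      omega
    rw [h1, Finset.sum_insert (by simp), Finset.Ico_eq_empty (a := 0) (by omega),
      Finset.Ico_eq_empty (a := 0) (by omega)]
    ring

lemma strictMono_emitterPos (l : ℤ → ℕ) : StrictMono (emitterPos l) :=
  strictMono_int_of_lt_succ fun j => by
    rw [emitterPos_add_one]
    omega

/-- The shift of the sequences of lengths and states. -/
def seqShift (l : ℤ → ℕ) : ℤ → ℕ := fun i => l (i + 1)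

lemma measurable_seqShift : Measurable seqShift :=
  measurable_pi_lambda _ fun i => measurable_pi_apply (i + 1)

lemma emitterPos_seqShift (l : ℤ → ℕ) (j : ℤ) :
    emitterPos (seqShift l) j = emitterPos l (j + 1) - (l 0 + 1) := by
  induction j using Int.induction_on with
  | zero =>
    rw [emitterPos_add_one, emitterPos_zero, emitterPos_zero]
    ring
  | succ n ih =>
    rw [emitterPos_add_one, emitterPos_add_one l (n + 1), ih, seqShift]
    ring
  | pred n ih =>
    have h1 := emitterPos_add_one (seqShift l) (-n - 1)
    have h2 := emitterPos_add_one l (-n - 1 + 1)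
    rw [sub_add_cancel] at h1 h2 ⊢
    rw [seqShift, sub_add_cancel] at h1
    linarith

/-- Moving the origin to the next emitter amounts to renumbering the counters. -/
lemma shift_iterate_writeCounters (l c : ℤ → ℕ) :
    shift^[l 0 + 1] (writeCounters l c) = writeCounters (seqShift l) (seqShift c) := by
  funext p
  rw [shift_iterate_apply]
  unfold writeCounters
  have hs (q : ℤ → Prop) : (∃ j, q j) ↔ ∃ j, q (j + 1) :=
    ⟨fun ⟨j, hj⟩ => ⟨j - 1, by rwa [sub_add_cancel]⟩, fun ⟨j, hj⟩ => ⟨j + 1, hj⟩⟩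
  have e1 : (∃ j, p + ((l 0 + 1 : ℕ) : ℤ) = emitterPos l j) ↔
      ∃ j, p = emitterPos (seqShift l) j := by
    rw [hs]
    refine exists_congr fun j => ?_
    rw [emitterPos_seqShift]
    push_cast
    constructor <;> intro h <;> linarith
  have e2 : (∃ j, emitterPos l j < p + ((l 0 + 1 : ℕ) : ℤ) ∧
      p + ((l 0 + 1 : ℕ) : ℤ) < emitterPos l (j + 1) ∧
        (c j).testBit (p + ((l 0 + 1 : ℕ) : ℤ) - emitterPos l j - 1).toNat = true) ↔
      ∃ j, emitterPos (seqShift l) j < p ∧ p < emitterPos (seqShift l) (j + 1) ∧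
        (seqShift c j).testBit (p - emitterPos (seqShift l) j - 1).toNat = true := by
    rw [hs]
    refine exists_congr fun j => ?_
    have h : p + ((l 0 + 1 : ℕ) : ℤ) - emitterPos l (j + 1) - 1
        = p - emitterPos (seqShift l) j - 1 := by
      rw [emitterPos_seqShift]
      push_cast
      ring
    rw [h, emitterPos_seqShift, emitterPos_seqShift, seqShift]
    push_cast
    refine and_congr ?_ (and_congr ?_ Iff.rfl) <;> constructor <;> intro h <;> linarith
  classical
  exact if_congr e1 rfl (if_congr e2 rfl rfl)

lemma writeCounters_eq_emitter_iff (l c : ℤ → ℕ) (p : ℤ) :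
    writeCounters l c p = emitter ↔ ∃ j, p = emitterPos l j := by
  unfold writeCounters
  split_ifs with h1 h2 <;> simp [h1, emitter]

lemma emittersSpaced_shift_iterate_writeCounters {l : ℤ → ℕ} (hl : ∀ j, 3 ≤ l j) (c : ℤ → ℕ)
    (k : ℕ) : EmittersSpaced (shift^[k] (writeCounters l c)) := by
  intro i hi i' hi' hii'
  rw [shift_iterate_apply, writeCounters_eq_emitter_iff] at hi hi'
  obtain ⟨j, hj⟩ := hi
  obtain ⟨j', hj'⟩ := hi'
  have hjj' : j < j' := (strictMono_emitterPos l).lt_iff_lt.1 (by omega)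
  have h1 := (strictMono_emitterPos l).monotone (show j + 1 ≤ j' by omega)
  rw [emitterPos_add_one] at h1
  have := hl j
  omega

/-! ### Invariance under the shift -/

lemma map_seqShift_infinitePi (μ : ℤ → Measure ℕ) [∀ i, IsProbabilityMeasure (μ i)] :
    (Measure.infinitePi μ).map seqShift = Measure.infinitePi fun i => μ (i + 1) := by
  refine Measure.eq_infinitePi _ fun s t ht => ?_
  have h : seqShift ⁻¹' (s : Set ℤ).pi t
      = ((s.map (addRightEmbedding 1) : Finset ℤ) : Set ℤ).pi fun i => t (i - 1) := by
    ext l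
    simp only [Set.mem_preimage, Set.mem_pi, Finset.mem_coe, Finset.forall_mem_map,
      addRightEmbedding_apply, add_sub_cancel_right, seqShift]
  rw [Measure.map_apply measurable_seqShift
    (MeasurableSet.pi s.countable_toSet fun i hi => ht i), h,
    Measure.infinitePi_pi _ fun i _ => ht (i - 1), Finset.prod_map]
  simp

lemma map_seqShift_stateLaw (l : ℤ → ℕ) : (stateLaw l).map seqShift = stateLaw (seqShift l) :=
  map_seqShift_infinitePi _

lemma measurePreserving_seqShift_lengthSeqLaw (ν : ℝ) (hν : ν ∈ Set.Ioo (0 : ℝ) 1) :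
    MeasurePreserving seqShift (lengthSeqLaw ν hν) (lengthSeqLaw ν hν) :=
  ⟨measurable_seqShift, map_seqShift_infinitePi _⟩

lemma initialMeasure_apply (ν : ℝ) (hν : ν ∈ Set.Ioo (0 : ℝ) 1) {s : Set Config}
    (hs : MeasurableSet s) :
    initialMeasure ν hν s = (meanLength ν hν + 1)⁻¹ *
      ∫⁻ l, ∑ k ∈ Finset.range (l 0 + 1), stateLaw l {c | shift^[k] (writeCounters l c) ∈ s}
        ∂lengthSeqLaw ν hν := by
  rw [initialMeasure, Measure.smul_apply, smul_eq_mul,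
    Measure.bind_apply hs measurable_fibreMeasure.aemeasurable]
  simp_rw [fibreMeasure_apply _ hs]

/-- Shifting replaces, in the sum over the positions of the origin, the position `s_0` by `s_1`;
the law of the counters seen from `s_1` is the same as seen from `s_0`. -/
lemma map_shift_initialMeasure (ν : ℝ) (hν : ν ∈ Set.Ioo (0 : ℝ) 1) :
    (initialMeasure ν hν).map shift = initialMeasure ν hν := by
  ext s hs
  rw [Measure.map_apply measurable_shift hs, initialMeasure_apply ν hν hs,
    initialMeasure_apply ν hν (measurable_shift hs)]
  congr 1
  set g : ℕ → (ℤ → ℕ) → ENNReal :=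
    fun k l => stateLaw l {c | shift^[k] (writeCounters l c) ∈ s} with hg
  have hgm (k : ℕ) : Measurable (g k) := measurable_stateLaw_section
    (((measurable_shift.iterate k).comp measurable_writeCounters) hs)
  have h1 : ∀ l : ℤ → ℕ, ∀ k : ℕ,
      stateLaw l {c | shift^[k] (writeCounters l c) ∈ shift ⁻¹' s} = g (k + 1) l := by
    intro l k
    simp only [hg, Set.mem_preimage, Function.iterate_succ_apply']
  simp_rw [h1]
  change ∫⁻ l, ∑ k ∈ Finset.range (l 0 + 1), g (k + 1) l ∂lengthSeqLaw ν hν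
    = ∫⁻ l, ∑ k ∈ Finset.range (l 0 + 1), g k l ∂lengthSeqLaw ν hν
  have h2 : ∀ l : ℤ → ℕ, g (l 0 + 1) l = g 0 (seqShift l) := by
    intro l
    simp only [hg, shift_iterate_writeCounters, Function.iterate_zero, id_eq]
    rw [← map_seqShift_stateLaw, Measure.map_apply measurable_seqShift]
    · rfl
    · exact (measurable_writeCounters.comp (measurable_const.prodMk measurable_id)) hs
  have h3 : ∫⁻ l, g 0 (seqShift l) ∂lengthSeqLaw ν hν = ∫⁻ l, g 0 l ∂lengthSeqLaw ν hν :=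
    (measurePreserving_seqShift_lengthSeqLaw ν hν).lintegral_comp (hgm 0)
  have h4 : ∫⁻ l, g 0 l ∂lengthSeqLaw ν hν ≠ ⊤ := by
    refine ne_top_of_le_ne_top (b := 1) (by simp) ?_
    calc ∫⁻ l, g 0 l ∂lengthSeqLaw ν hν ≤ ∫⁻ _, 1 ∂lengthSeqLaw ν hν :=
          lintegral_mono fun l => prob_le_one
      _ = 1 := by simp
  refine (ENNReal.add_left_inj h4).1 ?_
  rw [← lintegral_add_right _ (hgm 0)]
  have h5 : Measurable fun l => g 0 (seqShift l) := (hgm 0).comp measurable_seqShift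
  conv_rhs => rw [← h3, ← lintegral_add_right _ h5]
  refine lintegral_congr fun l => ?_
  rw [← h2, ← Finset.sum_range_succ fun k => g k l, Finset.sum_range_succ' fun k => g k l]

lemma map_shift_cesaroMeasure (ν : ℝ) (hν : ν ∈ Set.Ioo (0 : ℝ) 1) (n : ℕ) :
    (cesaroMeasure ν hν n).map shift = cesaroMeasure ν hν n := by
  have h (k : ℕ) : ((initialMeasure ν hν).map aut^[k]).map shift
      = (initialMeasure ν hν).map aut^[k] := by
    have hc : shift ∘ aut^[k] = aut^[k] ∘ shift := by
      have : Function.Commute shift aut := fun x => shift_aut x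
      exact (this.iterate_right k).comp_eq
    rw [Measure.map_map measurable_shift (measurable_aut.iterate k), hc,
      ← Measure.map_map (measurable_aut.iterate k) measurable_shift, map_shift_initialMeasure]
  ext s hs
  rw [Measure.map_apply measurable_shift hs, cesaroMeasure, Measure.smul_apply,
    Measure.smul_apply, Measure.finsetSum_apply, Measure.finsetSum_apply]
  congr 1
  refine Finset.sum_congr rfl fun k _ => ?_
  rw [← Measure.map_apply measurable_shift hs, h]

lemma IsLimitMeasure.measurePreserving_shift {ν : ℝ} {hν : ν ∈ Set.Ioo (0 : ℝ) 1}
    {μ : ProbabilityMeasure Config} (hμ : IsLimitMeasure ν hν μ) :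
    MeasurePreserving shift (μ : Measure Config) (μ : Measure Config) := by
  obtain ⟨n, -, h⟩ := hμ
  refine ⟨measurable_shift, ?_⟩
  have h1 := ProbabilityMeasure.tendsto_map_of_tendsto_of_continuous _ _ h continuous_shift
  have h2 (j : ℕ) : (cesaroMean ν hν (n j)).map continuous_shift.measurable.aemeasurable
      = cesaroMean ν hν (n j) :=
    ProbabilityMeasure.toMeasure_injective (map_shift_cesaroMeasure ν hν (n j))
  simp_rw [h2] at h1
  exact congrArg ProbabilityMeasure.toMeasure (tendsto_nhds_unique h1 h)

/-! ### Invariance under the automaton -/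

lemma integral_cesaroMeasure (ν : ℝ) (hν : ν ∈ Set.Ioo (0 : ℝ) 1) (n : ℕ)
    (f : BoundedContinuousFunction Config ℝ) :
    ∫ x, f x ∂cesaroMeasure ν hν n
      = ((n : ℝ) + 1)⁻¹ * ∑ k ∈ Finset.range (n + 1), ∫ x, f (aut^[k] x) ∂initialMeasure ν hν := by
  have hp (k : ℕ) : IsProbabilityMeasure ((initialMeasure ν hν).map aut^[k]) :=
    Measure.isProbabilityMeasure_map (measurable_aut.iterate k).aemeasurable
  rw [cesaroMeasure, integral_smul_measure, integral_finsetSum_measure fun k _ => f.integrable _]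
  congr 1
  · simp [ENNReal.toReal_add]
  · refine Finset.sum_congr rfl fun k _ => ?_
    exact integral_map (measurable_aut.iterate k).aemeasurable
      f.continuous.measurable.aestronglyMeasurable

/-- The integrals of `f` and of `f ∘ F` against the `n`-th Cesàro mean differ by the first and the
last term of a telescoping sum. -/
lemma abs_integral_aut_sub_integral_cesaroMeasure_le (ν : ℝ) (hν : ν ∈ Set.Ioo (0 : ℝ) 1) (n : ℕ)
    (f : BoundedContinuousFunction Config ℝ) :
    |∫ x, f (aut x) ∂cesaroMeasure ν hν n - ∫ x, f x ∂cesaroMeasure ν hν n|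
      ≤ ((n : ℝ) + 1)⁻¹ * (2 * ‖f‖) := by
  have h1 := integral_cesaroMeasure ν hν n f
  have h2 := integral_cesaroMeasure ν hν n (f.compContinuous ⟨aut, continuous_aut⟩)
  simp only [BoundedContinuousFunction.compContinuous_apply, ContinuousMap.coe_mk] at h2
  rw [h1, h2, ← mul_sub, ← Finset.sum_sub_distrib]
  simp_rw [← Function.iterate_succ_apply' aut]
  rw [Finset.sum_range_sub (fun k => ∫ x, f (aut^[k] x) ∂initialMeasure ν hν), abs_mul,
    abs_of_nonneg (by positivity)]
  refine mul_le_mul_of_nonneg_left ?_ (by positivity)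
  have hb (k : ℕ) : |∫ x, f (aut^[k] x) ∂initialMeasure ν hν| ≤ ‖f‖ := by
    have := norm_integral_le_of_norm_le_const (μ := initialMeasure ν hν)
      (f := fun x => f (aut^[k] x)) (C := ‖f‖) (ae_of_all _ fun x => f.norm_coe_le_norm _)
    simpa using this
  calc _ ≤ _ := abs_sub _ _
    _ ≤ 2 * ‖f‖ := by linarith [hb (n + 1), hb 0]

lemma IsLimitMeasure.measurePreserving_aut {ν : ℝ} {hν : ν ∈ Set.Ioo (0 : ℝ) 1}
    {μ : ProbabilityMeasure Config} (hμ : IsLimitMeasure ν hν μ) :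
    MeasurePreserving aut (μ : Measure Config) (μ : Measure Config) := by
  obtain ⟨n, hn, h⟩ := hμ
  refine ⟨measurable_aut, ?_⟩
  have hp : IsProbabilityMeasure ((μ : Measure Config).map aut) :=
    Measure.isProbabilityMeasure_map measurable_aut.aemeasurable
  refine ext_of_forall_integral_eq_of_IsFiniteMeasure fun f => ?_
  rw [integral_map measurable_aut.aemeasurable f.continuous.measurable.aestronglyMeasurable]
  rw [ProbabilityMeasure.tendsto_iff_forall_integral_tendsto] at h
  have h1 := (h (f.compContinuous ⟨aut, continuous_aut⟩)).sub (h f)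
  refine sub_eq_zero.1 (tendsto_nhds_unique h1 (squeeze_zero_norm
    (fun j => abs_integral_aut_sub_integral_cesaroMeasure_le ν hν (n j) f) ?_))
  rw [← zero_mul (2 * ‖f‖)]
  refine Tendsto.mul_const _ (tendsto_inv_atTop_zero.comp ?_)
  exact tendsto_atTop_add_const_right _ _ (tendsto_natCast_atTop_atTop.comp hn.tendsto_atTop)

/-! ### The emitters of a limit measure -/

lemma ae_three_le_lengthSeqLaw (ν : ℝ) (hν : ν ∈ Set.Ioo (0 : ℝ) 1) :
    ∀ᵐ l ∂lengthSeqLaw ν hν, ∀ j, 3 ≤ l j := by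
  rw [ae_all_iff]
  intro j
  have h := (measurePreserving_eval_infinitePi (fun _ : ℤ => (lengthLaw ν hν).toMeasure) j)
  refine h.quasiMeasurePreserving.ae (p := fun n : ℕ => 3 ≤ n) ?_
  rw [ae_iff, PMF.toMeasure_apply_eq_zero_iff _ (Set.to_countable _).measurableSet,
    Set.disjoint_left]
  intro k hk hk'
  rw [PMF.mem_support_iff, lengthLaw, PMF.normalize_apply] at hk
  exact hk (by simp [lengthWeight, show ¬ 3 ≤ k from hk'])

lemma isClopen_setOf_emitters (S : Finset ℤ) (w : ℤ → Prop) :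
    IsClopen {x : Config | ∀ i ∈ S, (x i = emitter ↔ w i)} := by
  have h : {x : Config | ∀ i ∈ S, (x i = emitter ↔ w i)}
      = ⋂ i ∈ S, (fun x : Config => x i) ⁻¹' {a | a = emitter ↔ w i} := by
    ext x
    simp
  rw [h]
  exact isClopen_biInter_finset fun i _ => (isClopen_discrete _).preimage (continuous_apply i)

/-- The law of the set of emitters is the same under the initial measure and under its limits. -/
lemma IsLimitMeasure.apply_emitters {ν : ℝ} {hν : ν ∈ Set.Ioo (0 : ℝ) 1}
    {μ : ProbabilityMeasure Config} (hμ : IsLimitMeasure ν hν μ) (S : Finset ℤ) (w : ℤ → Prop) :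
    (μ : Measure Config) {x | ∀ i ∈ S, (x i = emitter ↔ w i)}
      = initialMeasure ν hν {x | ∀ i ∈ S, (x i = emitter ↔ w i)} := by
  obtain ⟨n, hn, h⟩ := hμ
  set I : Set Config := {x | ∀ i ∈ S, (x i = emitter ↔ w i)} with hI
  have hIc : IsClopen I := isClopen_setOf_emitters S w
  have hIm : MeasurableSet I := hIc.isOpen.measurableSet
  have h1 (k : ℕ) : (initialMeasure ν hν).map aut^[k] I = initialMeasure ν hν I := by
    have hm : MeasurableSet (aut^[k] ⁻¹' I) := measurable_aut.iterate k hIm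
    rw [Measure.map_apply (measurable_aut.iterate k) hIm, initialMeasure_apply ν hν hm,
      initialMeasure_apply ν hν hIm]
    congr 1
    refine lintegral_congr_ae ?_
    filter_upwards [ae_three_le_lengthSeqLaw ν hν] with l hl
    refine Finset.sum_congr rfl fun k' _ => ?_
    congr 1
    ext c
    have := aut_iterate_eq_emitter_iff (emittersSpaced_shift_iterate_writeCounters hl c k') k
    simp only [hI, Set.mem_ofPred_eq, Set.mem_preimage, this]
  have h2 (m : ℕ) : cesaroMeasure ν hν m I = initialMeasure ν hν I := by
    rw [cesaroMeasure, Measure.smul_apply, Measure.finsetSum_apply]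
    simp_rw [h1]
    simp only [Finset.sum_const, Finset.card_range, nsmul_eq_mul, smul_eq_mul]
    push_cast
    rw [← mul_assoc, ENNReal.inv_mul_cancel (by simp) (by simp), one_mul]
  have h3 := ProbabilityMeasure.tendsto_measure_of_null_frontier_of_tendsto' h (E := I)
    (by simp [hIc])
  have h4 (j : ℕ) : (cesaroMean ν hν (n j) : Measure Config) I = initialMeasure ν hν I := h2 (n j)
  simp_rw [h4] at h3
  exact tendsto_nhds_unique h3 tendsto_const_nhds

/-! ### The law of the lengths -/

lemma tsum_lengthWeight {ν : ℝ} (hν : ν ∈ Set.Ioo (0 : ℝ) 1) :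
    ∑' k, lengthWeight ν k = ENNReal.ofReal (ν ^ 3 / (1 - ν)) := by
  have h0 (k : ℕ) : 0 ≤ ν ^ (k + 3) := pow_nonneg hν.1.le _
  have h1 : HasSum (fun k : ℕ => ν ^ (k + 3)) (ν ^ 3 / (1 - ν)) := by
    have h2 := (hasSum_geometric_of_lt_one hν.1.le hν.2).mul_left (ν ^ 3)
    rw [← div_eq_mul_inv] at h2
    exact h2.congr_fun fun k => by ring
  rw [← ENNReal.summable.sum_add_tsum_nat_add' (k := 3), ← h1.tsum_eq,
    ENNReal.ofReal_tsum_of_nonneg h0 h1.summable]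
  simp [lengthWeight, Finset.sum_range_succ]

lemma lengthLaw_add_three {ν : ℝ} (hν : ν ∈ Set.Ioo (0 : ℝ) 1) (k : ℕ) :
    lengthLaw ν hν (k + 3) = ENNReal.ofReal ((1 - ν) * ν ^ k) := by
  have h1 := hν.1
  have h2 : 0 < 1 - ν := sub_pos.2 hν.2
  rw [lengthLaw, PMF.normalize_apply, tsum_lengthWeight hν, lengthWeight, if_pos (by omega),
    ← ENNReal.ofReal_inv_of_pos (by positivity), ← ENNReal.ofReal_mul (by positivity)]
  congr 1
  field_simp
  ring

lemma lengthLaw_of_lt_three {ν : ℝ} (hν : ν ∈ Set.Ioo (0 : ℝ) 1) {k : ℕ} (hk : k < 3) :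
    lengthLaw ν hν k = 0 := by
  rw [lengthLaw, PMF.normalize_apply, lengthWeight, if_neg (by omega), zero_mul]

lemma measureReal_lengthLaw_singleton_le {ν : ℝ} (hν : ν ∈ Set.Ioo (0 : ℝ) 1) (b : ℕ) :
    ν ^ 3 * (lengthLaw ν hν).toMeasure.real {b} ≤ (1 - ν) * ν ^ b := by
  have h1 := hν.1
  have h2 : 0 < 1 - ν := sub_pos.2 hν.2
  rw [measureReal_def, PMF.toMeasure_apply_singleton _ _ (measurableSet_singleton b)]
  rcases lt_or_ge b 3 with hb | hb
  · rw [lengthLaw_of_lt_three hν hb, ENNReal.toReal_zero, mul_zero]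
    positivity
  · obtain ⟨k, rfl⟩ := Nat.exists_eq_add_of_le' hb
    rw [lengthLaw_add_three, ENNReal.toReal_ofReal (by positivity)]
    apply le_of_eq
    ring

lemma measureReal_lengthLaw_Ici_add_three {ν : ℝ} (hν : ν ∈ Set.Ioo (0 : ℝ) 1) (b : ℕ) :
    (lengthLaw ν hν).toMeasure.real (Set.Ici (b + 3)) = ν ^ b := by
  have h1 := hν.1
  have h2 : 0 < 1 - ν := sub_pos.2 hν.2
  induction b with
  | zero =>
    rw [measureReal_def, (PMF.toMeasure_apply_eq_one_iff _ (Set.to_countable _).measurableSet).2]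
    · simp
    · intro k hk
      by_contra hk'
      exact hk (lengthLaw_of_lt_three hν (by simpa using hk'))
  | succ b ih =>
    have h3 : Set.Ici (b + 3) = {b + 3} ∪ Set.Ici (b + 1 + 3) := by
      ext k
      simp only [Set.mem_Ici, Set.mem_union, Set.mem_singleton_iff]
      omega
    have h4 : Disjoint {b + 3} (Set.Ici (b + 1 + 3)) := by
      rw [Set.disjoint_singleton_left, Set.mem_Ici]
      omega
    rw [h3, measureReal_union h4 (Set.to_countable _).measurableSet, measureReal_def,
      PMF.toMeasure_apply_singleton _ _ (measurableSet_singleton _), lengthLaw_add_three,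
      ENNReal.toReal_ofReal (by positivity)] at ih
    rw [pow_succ]
    linarith

lemma measureReal_lengthLaw_Ici_le {ν : ℝ} (hν : ν ∈ Set.Ioo (0 : ℝ) 1) (b : ℕ) :
    ν ^ 3 * (lengthLaw ν hν).toMeasure.real (Set.Ici b) ≤ ν ^ b := by
  rcases lt_or_ge b 3 with hb | hb
  · calc ν ^ 3 * (lengthLaw ν hν).toMeasure.real (Set.Ici b) ≤ ν ^ 3 * 1 :=
          mul_le_mul_of_nonneg_left measureReal_le_one (pow_nonneg hν.1.le 3)
      _ ≤ ν ^ b := by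
          rw [mul_one]
          exact pow_le_pow_of_le_one hν.1.le hν.2.le hb.le
  · obtain ⟨k, rfl⟩ := Nat.exists_eq_add_of_le' hb
    rw [measureReal_lengthLaw_Ici_add_three]
    apply le_of_eq
    ring

lemma meanLength_eq {ν : ℝ} (hν : ν ∈ Set.Ioo (0 : ℝ) 1) :
    meanLength ν hν = ENNReal.ofReal (3 + ν / (1 - ν)) := by
  have h1 := hν.1
  have h2 : 0 < 1 - ν := sub_pos.2 hν.2
  have h0 (k : ℕ) : 0 ≤ (1 - ν) * ν ^ k * ((k : ℝ) + 3) := by positivity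
  have h3 : HasSum (fun k : ℕ => (1 - ν) * ν ^ k * ((k : ℝ) + 3)) (3 + ν / (1 - ν)) := by
    have h4 := (hasSum_coe_mul_geometric_of_norm_lt_one
      (by rw [Real.norm_eq_abs, abs_of_pos h1]; exact hν.2 : ‖ν‖ < 1)).mul_left (1 - ν)
    have h5 := (hasSum_geometric_of_lt_one h1.le hν.2).mul_left (3 * (1 - ν))
    have h6 := h5.add h4
    have e : 3 * (1 - ν) * (1 - ν)⁻¹ + (1 - ν) * (ν / (1 - ν) ^ 2) = 3 + ν / (1 - ν) := by
      field_simp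
    rw [e] at h6
    refine h6.congr_fun fun k => ?_
    ring
  rw [meanLength, ← ENNReal.summable.sum_add_tsum_nat_add' (k := 3), ← h3.tsum_eq,
    ENNReal.ofReal_tsum_of_nonneg h0 h3.summable]
  have h6 : ∑ k ∈ Finset.range 3, lengthLaw ν hν k * (k : ENNReal) = 0 :=
    Finset.sum_eq_zero fun k hk => by
      rw [lengthLaw_of_lt_three hν (Finset.mem_range.1 hk), zero_mul]
  rw [h6, zero_add]
  refine tsum_congr fun k => ?_
  have h7 : ((k + 3 : ℕ) : ENNReal) = ENNReal.ofReal ((k : ℝ) + 3) := by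
    rw [← ENNReal.ofReal_natCast]
    push_cast
    rfl
  rw [lengthLaw_add_three, h7, ← ENNReal.ofReal_mul (by positivity)]

/-! ### The probability of a pattern of emitters -/

lemma eq_add_one_of_emitterPos_eq {l : ℤ → ℕ} {j i : ℤ} {b : ℕ} (hb : b ≤ l j)
    (h : emitterPos l j + b + 1 = emitterPos l i) : i = j + 1 ∧ l j = b := by
  have h1 : j < i := (strictMono_emitterPos l).lt_iff_lt.1 (by omega)
  have h2 := emitterPos_add_one l j
  have h3 : i ≤ j + 1 := (strictMono_emitterPos l).le_iff_le.1 (by omega)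
  obtain rfl : i = j + 1 := by omega
  exact ⟨rfl, by omega⟩

lemma measureReal_lengthSeqLaw_pi {ν : ℝ} (hν : ν ∈ Set.Ioo (0 : ℝ) 1) (s : Finset ℤ)
    (t : ℤ → Set ℕ) :
    (lengthSeqLaw ν hν).real ((s : Set ℤ).pi t)
      = ∏ i ∈ s, (lengthLaw ν hν).toMeasure.real (t i) := by
  rw [measureReal_def, lengthSeqLaw,
    Measure.infinitePi_pi _ fun i _ => (Set.to_countable (t i)).measurableSet,
    ENNReal.toReal_prod]
  rfl

lemma measureReal_lengthSeqLaw_insert {ν : ℝ} (hν : ν ∈ Set.Ioo (0 : ℝ) 1) {s : Finset ℤ} {j : ℤ}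
    (hj : j ∉ s) (t : ℤ → Set ℕ) (D : Set ℕ) :
    (lengthSeqLaw ν hν).real (((insert j s : Finset ℤ) : Set ℤ).pi (Function.update t j D))
      = (lengthSeqLaw ν hν).real ((s : Set ℤ).pi t) * (lengthLaw ν hν).toMeasure.real D := by
  rw [measureReal_lengthSeqLaw_pi, measureReal_lengthSeqLaw_pi, Finset.prod_insert hj,
    Function.update_self, mul_comm]
  congr 1
  refine Finset.prod_congr rfl fun i hi => ?_
  rw [Function.update_of_ne]
  rintro rfl
  exact hj hi

lemma mem_pi_insert_update {s : Finset ℤ} {j : ℤ} {t : ℤ → Set ℕ} {D : Set ℕ} {l : ℤ → ℕ}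
    (hl : l ∈ (s : Set ℤ).pi t) (hD : l j ∈ D) :
    l ∈ ((insert j s : Finset ℤ) : Set ℤ).pi (Function.update t j D) := by
  intro i hi
  rcases eq_or_ne i j with rfl | hij
  · rwa [Function.update_self]
  · rw [Function.update_of_ne hij]
    rw [Finset.mem_coe, Finset.mem_insert] at hi
    exact hl i (Finset.mem_coe.2 (hi.resolve_left hij))

/-- The set of lengths for which `l_j` is at least `b`, and the pattern `w` is the pattern of the
emitters at the `n` positions which follow the position at distance `b` to the right of `s_j`. -/
def patternSet (w : ℕ → Prop) (n b : ℕ) (j : ℤ) : Set (ℤ → ℕ) :=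
  {l | b ≤ l j ∧ ∀ i < n, ((∃ j', emitterPos l j + b + 1 + i = emitterPos l j') ↔ w i)}

/-- A pattern with `m` emitters on `n` positions fixes the lengths of the counters which it
contains; each emitter costs a factor `1 - ν`, and each letter costs a factor `ν` unless it is an
emitter or one of the three letters after an emitter, `s_j` included, which cost nothing: hence the
exponent `3 + 4 m` on the left. The induction reads the pattern from left to right; the cylinder
`s.pi t` records the lengths of the counters already read. -/
lemma measureReal_inter_patternSet_le {ν : ℝ} (hν : ν ∈ Set.Ioo (0 : ℝ) 1) (n : ℕ) (w : ℕ → Prop)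
    [DecidablePred w] (b : ℕ) (j : ℤ) (s : Finset ℤ) (hs : ∀ i ∈ s, i < j) (t : ℤ → Set ℕ) :
    ν ^ (3 + 4 * Nat.count w n) *
        (lengthSeqLaw ν hν).real ((s : Set ℤ).pi t ∩ patternSet w n b j)
      ≤ (lengthSeqLaw ν hν).real ((s : Set ℤ).pi t) *
        (ν ^ (b + n) * (1 - ν) ^ Nat.count w n) := by
  have h1 := hν.1
  have h2 : 0 < 1 - ν := sub_pos.2 hν.2
  have hjs {j : ℤ} {s : Finset ℤ} (hs : ∀ i ∈ s, i < j) : j ∉ s := fun h => (hs j h).false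
  induction n generalizing w b j s t with
  | zero =>
    calc _ ≤ ν ^ 3 * (lengthSeqLaw ν hν).real
          (((insert j s : Finset ℤ) : Set ℤ).pi (Function.update t j (Set.Ici b))) := by
          rw [Nat.count_zero, mul_zero, add_zero]
          refine mul_le_mul_of_nonneg_left (measureReal_mono ?_) (by positivity)
          exact fun l hl => mem_pi_insert_update hl.1 hl.2.1
      _ = (lengthSeqLaw ν hν).real ((s : Set ℤ).pi t) *
          (ν ^ 3 * (lengthLaw ν hν).toMeasure.real (Set.Ici b)) := by
          rw [measureReal_lengthSeqLaw_insert hν (hjs hs)]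
          ring
      _ ≤ _ := by
          refine mul_le_mul_of_nonneg_left ?_ measureReal_nonneg
          simpa using measureReal_lengthLaw_Ici_le hν b
  | succ n ih =>
    rw [Nat.count_succ']
    by_cases hw : w 0
    · rw [if_pos hw]
      set m := Nat.count (fun k => w (k + 1)) n
      have h3 : (s : Set ℤ).pi t ∩ patternSet w (n + 1) b j
          ⊆ ((insert j s : Finset ℤ) : Set ℤ).pi (Function.update t j {b}) ∩
            patternSet (fun k => w (k + 1)) n 0 (j + 1) := by
        rintro l ⟨hlt, hb, hl⟩
        obtain ⟨j', hj'⟩ := (hl 0 (by omega)).2 hw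
        have h4 := (eq_add_one_of_emitterPos_eq hb (by simpa using hj')).2
        refine ⟨mem_pi_insert_update hlt h4, Nat.zero_le _, fun i hi => ?_⟩
        refine Iff.trans ?_ (hl (i + 1) (by omega))
        rw [emitterPos_add_one, h4]
        push_cast
        refine exists_congr fun i' => ?_
        constructor <;> intro h <;> linarith
      have h5 := ih (fun k => w (k + 1)) 0 (j + 1) (insert j s)
        (fun i hi => by
          rcases Finset.mem_insert.1 hi with rfl | hi
          · omega
          · have := hs i hi
            omega) (Function.update t j {b})
      rw [measureReal_lengthSeqLaw_insert hν (hjs hs), zero_add] at h5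
      have h6 := measureReal_lengthLaw_singleton_le hν b
      calc _ ≤ ν ^ (3 + 4 * (m + 1)) * (lengthSeqLaw ν hν).real
            (((insert j s : Finset ℤ) : Set ℤ).pi (Function.update t j {b}) ∩
              patternSet (fun k => w (k + 1)) n 0 (j + 1)) :=
            mul_le_mul_of_nonneg_left (measureReal_mono h3) (by positivity)
        _ = ν ^ 4 * (ν ^ (3 + 4 * m) * (lengthSeqLaw ν hν).real
            (((insert j s : Finset ℤ) : Set ℤ).pi (Function.update t j {b}) ∩
              patternSet (fun k => w (k + 1)) n 0 (j + 1))) := by ring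
        _ ≤ ν ^ 4 * ((lengthSeqLaw ν hν).real ((s : Set ℤ).pi t) *
            (lengthLaw ν hν).toMeasure.real {b} * (ν ^ n * (1 - ν) ^ m)) :=
            mul_le_mul_of_nonneg_left h5 (by positivity)
        _ = (lengthSeqLaw ν hν).real ((s : Set ℤ).pi t) * (ν ^ (n + 1) * (1 - ν) ^ m) *
            (ν ^ 3 * (lengthLaw ν hν).toMeasure.real {b}) := by ring
        _ ≤ (lengthSeqLaw ν hν).real ((s : Set ℤ).pi t) * (ν ^ (n + 1) * (1 - ν) ^ m) *
            ((1 - ν) * ν ^ b) :=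
            mul_le_mul_of_nonneg_left h6 (by positivity)
        _ = _ := by ring
    · rw [if_neg hw, add_zero, show b + (n + 1) = b + 1 + n by omega]
      refine le_trans (mul_le_mul_of_nonneg_left (measureReal_mono ?_) (by positivity))
        (ih (fun k => w (k + 1)) (b + 1) j s hs t)
      rintro l ⟨hlt, hb, hl⟩
      refine ⟨hlt, ?_, fun i hi => ?_⟩
      · by_contra hb'
        refine hw ((hl 0 (by omega)).1 ⟨j + 1, ?_⟩)
        rw [emitterPos_add_one]
        push_cast
        omega
      · refine Iff.trans ?_ (hl (i + 1) (by omega))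
        push_cast
        refine exists_congr fun i' => ?_
        constructor <;> intro h <;> linarith

lemma measurableSet_setOf_emitters (n : ℕ) (w : ℕ → Prop) :
    MeasurableSet {x : Config | ∀ i < n, (x (i + 1) = emitter ↔ w i)} := by
  have h : {x : Config | ∀ i < n, (x (i + 1) = emitter ↔ w i)}
      = ⋂ i ∈ Set.Iio n, (fun x : Config => x ((i : ℤ) + 1)) ⁻¹' {a | a = emitter ↔ w i} := by
    ext x
    simp
  rw [h]
  exact MeasurableSet.biInter (Set.to_countable _) fun i _ =>
    measurable_pi_apply _ (Set.to_countable _).measurableSet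

/-- Summing the bound for patterns over the distance between the origin and the emitter on its
left. -/
lemma initialMeasure_pattern_le {ν : ℝ} (hν : ν ∈ Set.Ioo (0 : ℝ) 1) (n : ℕ) (w : ℕ → Prop)
    [DecidablePred w] :
    (initialMeasure ν hν).real {x | ∀ i < n, (x (i + 1) = emitter ↔ w i)}
      ≤ (ν ^ 3 * (1 - ν))⁻¹ * (ν ^ n * (ν ^ (4 * Nat.count w n))⁻¹ * (1 - ν) ^ Nat.count w n) := by
  have h1 := hν.1
  have h2 : 0 < 1 - ν := sub_pos.2 hν.2
  set m := Nat.count w n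
  set K : ℝ := ν ^ n * (ν ^ (3 + 4 * m))⁻¹ * (1 - ν) ^ m with hK
  have hK0 : 0 ≤ K := by positivity
  have hb (b : ℕ) : lengthSeqLaw ν hν (patternSet w n b 0) ≤ ENNReal.ofReal (K * ν ^ b) := by
    have h := measureReal_inter_patternSet_le hν n w b 0 ∅ (by simp) fun _ => Set.univ
    simp only [Finset.coe_empty, Set.empty_pi, Set.univ_inter, probReal_univ, one_mul] at h
    rw [← ofReal_measureReal]
    refine ENNReal.ofReal_le_ofReal ?_
    rw [mul_comm, ← le_div_iff₀ (by positivity)] at h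
    refine h.trans (le_of_eq ?_)
    rw [hK]
    field_simp
    ring
  have hm (b : ℕ) : MeasurableSet (patternSet w n b 0) := by
    have h : patternSet w n b 0 = {l | b ≤ l 0} ∩ ⋂ i ∈ Set.Iio n, {l | (∃ j',
        emitterPos l 0 + b + 1 + i = emitterPos l j') ↔ w i} := by
      ext l
      simp [patternSet]
    rw [h]
    refine (measurableSet_le measurable_const (measurable_pi_apply 0)).inter
      (MeasurableSet.biInter (Set.to_countable _) fun i _ => ?_)
    refine MeasurableSet.iff ?_ (MeasurableSet.const _)
    rw [Set.ofPred_exists]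
    exact MeasurableSet.iUnion fun j' => measurableSet_eq_fun
      ((((measurable_emitterPos 0).add_const _).add_const _).add_const _) (measurable_emitterPos j')
  have hI := measurableSet_setOf_emitters n w
  have hl (l : ℤ → ℕ) : ∑ k ∈ Finset.range (l 0 + 1), stateLaw l {c | shift^[k] (writeCounters l c)
      ∈ {x : Config | ∀ i < n, (x (i + 1) = emitter ↔ w i)}}
      ≤ ∑' k, (patternSet w n k 0).indicator 1 l := by
    refine le_trans (Finset.sum_le_sum fun k hk => ?_) (ENNReal.sum_le_tsum _)
    -- The emitters do not depend on the states `c`, so the event is empty or everything.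
    by_cases hp : l ∈ patternSet w n k 0
    · rw [Set.indicator_of_mem hp]
      exact prob_le_one
    · rw [Set.indicator_of_notMem hp, nonpos_iff_eq_zero]
      convert measure_empty (μ := stateLaw l)
      refine Set.eq_empty_of_forall_notMem fun c hc => hp ?_
      refine ⟨Nat.lt_succ_iff.1 (Finset.mem_range.1 hk), fun i hi => ?_⟩
      refine Iff.trans (exists_congr fun j => ?_) ((writeCounters_eq_emitter_iff l c _).symm.trans
        ((shift_iterate_apply k (writeCounters l c) (i + 1)).symm ▸ hc i hi))
      rw [emitterPos_zero]
      constructor <;> intro h <;> linarith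
  have hle : initialMeasure ν hν {x | ∀ i < n, (x (i + 1) = emitter ↔ w i)}
      ≤ ENNReal.ofReal (K * (1 - ν)⁻¹) := by
    have hs := (hasSum_geometric_of_lt_one h1.le hν.2).mul_left K
    calc _ ≤ 1 * ∫⁻ l, ∑' k, (patternSet w n k 0).indicator 1 l ∂lengthSeqLaw ν hν := by
          rw [initialMeasure_apply ν hν hI]
          exact mul_le_mul' (ENNReal.inv_le_one.2 le_add_self) (lintegral_mono hl)
      _ = ∑' k, lengthSeqLaw ν hν (patternSet w n k 0) := by
          rw [one_mul, lintegral_tsum fun k => (measurable_one.indicator (hm k)).aemeasurable]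
          exact tsum_congr fun k => lintegral_indicator_one (hm k)
      _ ≤ ∑' k, ENNReal.ofReal (K * ν ^ k) := ENNReal.tsum_le_tsum hb
      _ = ENNReal.ofReal (K * (1 - ν)⁻¹) := by
          rw [← ENNReal.ofReal_tsum_of_nonneg (fun k => by positivity) hs.summable, hs.tsum_eq]
  rw [measureReal_def]
  refine (ENNReal.toReal_le_of_le_ofReal (by positivity) hle).trans (le_of_eq ?_)
  rw [hK, pow_add]
  field_simp

/-- The density of the emitters is the inverse of the mean distance between two of them. -/
lemma initialMeasure_emitter {ν : ℝ} (hν : ν ∈ Set.Ioo (0 : ℝ) 1) :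
    (initialMeasure ν hν).real {x | x 0 = emitter} = (1 - ν) / (4 - 3 * ν) := by
  have h1 := hν.1
  have h2 : 0 < 1 - ν := sub_pos.2 hν.2
  have h3 : 0 < 4 - 3 * ν := by linarith
  have hI : MeasurableSet {x : Config | x 0 = emitter} :=
    measurableSet_eq_fun (measurable_pi_apply 0) measurable_const
  have hl (l : ℤ → ℕ) : ∑ k ∈ Finset.range (l 0 + 1), stateLaw l
      {c | shift^[k] (writeCounters l c) ∈ {x : Config | x 0 = emitter}} = 1 := by
    have hk (k : ℕ) (hk : k ∈ Finset.range (l 0 + 1)) (c : ℤ → ℕ) :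
        shift^[k] (writeCounters l c) 0 = emitter ↔ k = 0 := by
      rw [shift_iterate_apply, writeCounters_eq_emitter_iff, zero_add]
      constructor
      · rintro ⟨j, hj⟩
        have h4 := emitterPos_add_one l 0
        rw [zero_add, emitterPos_zero] at h4
        have h5 : j < 1 := (strictMono_emitterPos l).lt_iff_lt.1 (by
          rw [Finset.mem_range] at hk
          omega)
        have h6 := (strictMono_emitterPos l).monotone (show j ≤ 0 by omega)
        rw [emitterPos_zero] at h6
        omega
      · rintro rfl
        exact ⟨0, by rw [emitterPos_zero]; rfl⟩
    rw [Finset.sum_eq_single_of_mem 0 (by simp)]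
    · have h0 : {c | shift^[0] (writeCounters l c) ∈ {x : Config | x 0 = emitter}} = Set.univ :=
        Set.eq_univ_of_forall fun c => (hk 0 (by simp) c).2 rfl
      rw [h0, measure_univ]
    · intro k hkr hk0
      simp [Set.mem_ofPred_eq, hk k hkr, hk0]
  rw [measureReal_def, initialMeasure_apply ν hν hI]
  simp_rw [hl]
  rw [lintegral_one, measure_univ, mul_one, meanLength_eq, ← ENNReal.ofReal_one,
    ← ENNReal.ofReal_add (by positivity) zero_le_one, ENNReal.toReal_inv,
    ENNReal.toReal_ofReal (by positivity), eq_div_iff h3.ne']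
  field_simp
  ring

noncomputable section

/-! ### The entropy of the emitters -/

/-- If the atoms of a partition are bounded by the numbers `q a`, the entropy of the partition is
at least the mean of `-log q`. -/
lemma sum_mul_neg_log_le_partitionEntropy {X ι : Type*} [MeasurableSpace X] [Fintype ι]
    (μ : Measure X) (α : X → ι) (q : ι → ℝ) (hq : ∀ a, μ.real (α ⁻¹' {a}) ≤ q a) :
    ∑ a, μ.real (α ⁻¹' {a}) * -Real.log (q a) ≤ partitionEntropy μ α := by
  refine Finset.sum_le_sum fun a _ => ?_
  rcases (measureReal_nonneg (μ := μ) (s := α ⁻¹' {a})).eq_or_lt with h | h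
  · simp [← h]
  · rw [Real.negMulLog, neg_mul, mul_neg]
    exact neg_le_neg (mul_le_mul_of_nonneg_left (Real.log_le_log h (hq a)) h.le)

/-- A lower bound, affine in `n`, for the entropy of the first `n` iterates bounds the metric entropy
below by the slope. -/
lemma le_metricEntropy_of_affine_le {X : Type*} [MeasurableSpace X] (T : X → X) (μ : Measure X)
    {k : ℕ} (α : X → Fin k) (hα : Measurable α) (h C : ℝ)
    (hC : ∀ n : ℕ, n * h - C ≤ partitionEntropy μ (itinerary T α n)) :
    (h : EReal) ≤ metricEntropy T μ := by
  refine le_trans ?_ (le_iSup_of_le k (le_iSup_of_le α (le_iSup_of_le hα le_rfl)))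
  have h1 : Tendsto (fun n : ℕ => ((h - C / n : ℝ) : EReal)) atTop (𝓝 (h : EReal)) := by
    refine (continuous_coe_real_ereal.tendsto h).comp ?_
    simpa using tendsto_const_nhds.sub (tendsto_const_div_atTop_nhds_zero_nat C)
  rw [← h1.liminf_eq, entropyOfPartition]
  refine liminf_le_liminf ?_
  filter_upwards [eventually_gt_atTop 0] with n hn
  have hn' : (0 : ℝ) < n := Nat.cast_pos.2 hn
  rw [EReal.coe_le_coe_iff, le_div_iff₀ hn', sub_mul, div_mul_cancel₀ _ hn'.ne', mul_comm]
  exact hC n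

/-- The partition according to whether there is an emitter at the position `1`. The position `1`
rather than `0` makes the windows start right after the origin, as in `patternSet`. -/
def emitterPartition (x : Config) : Fin 2 := if x 1 = emitter then 1 else 0

lemma measurable_emitterPartition : Measurable emitterPartition :=
  (measurable_of_countable fun a : Letter => if a = emitter then (1 : Fin 2) else 0).comp
    (measurable_pi_apply 1)

lemma emitterPartition_eq_one_iff (x : Config) : emitterPartition x = 1 ↔ x 1 = emitter := by
  unfold emitterPartition
  split_ifs with h <;> simp [h]

/-- The positions `i < n` which carry the symbol `1` in the word `a`. -/
def IsOneAt {n : ℕ} (a : Fin n → Fin 2) (i : ℕ) : Prop := ∃ h : i < n, a ⟨i, h⟩ = 1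

instance {n : ℕ} (a : Fin n → Fin 2) : DecidablePred (IsOneAt a) := fun i => by
  unfold IsOneAt
  infer_instance

lemma itinerary_preimage_singleton {n : ℕ} (a : Fin n → Fin 2) :
    itinerary shift emitterPartition n ⁻¹' {a}
      = {x | ∀ i < n, (x (i + 1) = emitter ↔ IsOneAt a i)} := by
  ext x
  have h2 (u v : Fin 2) : u = v ↔ (u = 1 ↔ v = 1) := by
    revert u v
    decide
  rw [Set.mem_preimage, Set.mem_singleton_iff, Set.mem_ofPred_eq, funext_iff, Fin.forall_iff]
  refine forall₂_congr fun i hi => ?_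
  rw [h2, itinerary, emitterPartition_eq_one_iff, shift_iterate_apply, add_comm (1 : ℤ)]
  simp [IsOneAt, hi]

lemma count_isOneAt {n : ℕ} (a : Fin n → Fin 2) :
    Nat.count (IsOneAt a) n = ∑ i, if a i = 1 then 1 else 0 := by
  rw [Nat.count_eq_card_filter_range, Finset.card_filter, Finset.sum_range]
  refine Finset.sum_congr rfl fun i _ => ?_
  simp [IsOneAt]

section Limit

variable {ν : ℝ} {hν : ν ∈ Set.Ioo (0 : ℝ) 1} {μ : ProbabilityMeasure Config}

lemma IsLimitMeasure.measureReal_pattern (hμ : IsLimitMeasure ν hν μ) (n : ℕ) (w : ℕ → Prop) :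
    (μ : Measure Config).real {x | ∀ i < n, (x (i + 1) = emitter ↔ w i)}
      = (initialMeasure ν hν).real {x | ∀ i < n, (x (i + 1) = emitter ↔ w i)} := by
  have h : {x : Config | ∀ i < n, (x (i + 1) = emitter ↔ w i)}
      = {x | ∀ p ∈ Finset.Ico (1 : ℤ) (n + 1), (x p = emitter ↔ w (p - 1).toNat)} := by
    ext x
    rw [Set.mem_ofPred_eq, Set.mem_ofPred_eq]
    constructor
    · intro hx p hp
      rw [Finset.mem_Ico] at hp
      have h1 := hx (p - 1).toNat (by omega)
      rwa [show (((p - 1).toNat : ℕ) : ℤ) + 1 = p by omega] at h1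
    · intro hx i hi
      have h1 := hx (i + 1) (by rw [Finset.mem_Ico]; omega)
      rwa [show ((i : ℤ) + 1 - 1).toNat = i by omega] at h1
  rw [measureReal_def, measureReal_def, h, hμ.apply_emitters]

lemma IsLimitMeasure.measureReal_emitter (hμ : IsLimitMeasure ν hν μ) (i : ℕ) :
    (μ : Measure Config).real {x | shift^[i] x 1 = emitter} = (1 - ν) / (4 - 3 * ν) := by
  have h1 := hμ.apply_emitters {0} fun _ => True
  simp only [Finset.mem_singleton, forall_eq, iff_true] at h1
  have hm : MeasurableSet {x : Config | x 0 = emitter} :=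
    measurableSet_eq_fun (measurable_pi_apply 0) measurable_const
  have h2 := (hμ.measurePreserving_shift.iterate (i + 1)).measureReal_preimage
    hm.nullMeasurableSet
  rw [measureReal_def (s := {x : Config | x 0 = emitter}), h1, ← measureReal_def,
    initialMeasure_emitter] at h2
  rw [← h2]
  congr 1
  ext x
  simp only [Set.mem_ofPred_eq, Set.mem_preimage, shift_iterate_apply]
  push_cast
  rw [zero_add, add_comm]

/-- The mean number of emitters in a window of length `n`. -/
lemma IsLimitMeasure.sum_mul_count (hμ : IsLimitMeasure ν hν μ) (n : ℕ) :
    ∑ a : Fin n → Fin 2, (μ : Measure Config).real (itinerary shift emitterPartition n ⁻¹' {a})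
      * (Nat.count (IsOneAt a) n : ℝ) = n * ((1 - ν) / (4 - 3 * ν)) := by
  have hm : Measurable (itinerary shift emitterPartition n) :=
    measurable_pi_lambda _ fun i => measurable_emitterPartition.comp (measurable_shift.iterate i)
  simp_rw [count_isOneAt]
  push_cast
  simp_rw [Finset.mul_sum]
  rw [Finset.sum_comm]
  have h (i : Fin n) : ∑ a : Fin n → Fin 2,
      (μ : Measure Config).real (itinerary shift emitterPartition n ⁻¹' {a})
        * (if a i = 1 then (1 : ℝ) else 0) = (1 - ν) / (4 - 3 * ν) := by
    simp_rw [mul_ite, mul_one, mul_zero]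
    rw [← Finset.sum_filter, sum_measureReal_preimage_singleton _
      fun a _ => hm (measurableSet_singleton a), ← hμ.measureReal_emitter i]
    congr 1
    ext x
    simp [itinerary, emitterPartition_eq_one_iff]
  simp_rw [h]
  simp

/-- The entropy of the emitters in a window of length `n`. -/
lemma IsLimitMeasure.affine_le_partitionEntropy (hμ : IsLimitMeasure ν hν μ) (n : ℕ) :
    n * ((-(ν * Real.log ν) - (1 - ν) * Real.log (1 - ν)) / (4 - 3 * ν))
        - Real.log (ν ^ 3 * (1 - ν))⁻¹
      ≤ partitionEntropy (μ : Measure Config) (itinerary shift emitterPartition n) := by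
  have h1 := hν.1
  have h2 : 0 < 1 - ν := sub_pos.2 hν.2
  have h3 : 0 < 4 - 3 * ν := by linarith
  have hm : Measurable (itinerary shift emitterPartition n) :=
    measurable_pi_lambda _ fun i => measurable_emitterPartition.comp (measurable_shift.iterate i)
  refine le_trans (le_of_eq ?_) (sum_mul_neg_log_le_partitionEntropy _ _
    (fun a => (ν ^ 3 * (1 - ν))⁻¹ * (ν ^ n * (ν ^ (4 * Nat.count (IsOneAt a) n))⁻¹ *
      (1 - ν) ^ Nat.count (IsOneAt a) n)) fun a => ?_)
  · have hlog (m : ℕ) : -Real.log ((ν ^ 3 * (1 - ν))⁻¹ * (ν ^ n * (ν ^ (4 * m))⁻¹ * (1 - ν) ^ m))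
        = (-Real.log (ν ^ 3 * (1 - ν))⁻¹ - n * Real.log ν)
          + (4 * Real.log ν - Real.log (1 - ν)) * m := by
      rw [Real.log_mul (by positivity) (by positivity), Real.log_mul (by positivity)
        (by positivity), Real.log_mul (by positivity) (by positivity), Real.log_inv (ν ^ (4 * m)),
        Real.log_pow, Real.log_pow, Real.log_pow]
      push_cast
      ring
    have hone : ∑ a : Fin n → Fin 2,
        (μ : Measure Config).real (itinerary shift emitterPartition n ⁻¹' {a}) = 1 := by
      rw [sum_measureReal_preimage_singleton _ fun a _ => hm (measurableSet_singleton a)]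
      simp
    simp_rw [hlog, mul_add]
    rw [Finset.sum_add_distrib, ← Finset.sum_mul, hone]
    simp_rw [mul_left_comm _ (4 * Real.log ν - Real.log (1 - ν))]
    rw [← Finset.mul_sum, hμ.sum_mul_count]
    have h4 : (4 - 3 * ν) * (4 - 3 * ν)⁻¹ = 1 := mul_inv_cancel₀ h3.ne'
    rw [div_eq_mul_inv, div_eq_mul_inv]
    linear_combination -(n * Real.log ν * h4)
  · rw [itinerary_preimage_singleton, hμ.measureReal_pattern]
    exact initialMeasure_pattern_le hν n _

lemma IsLimitMeasure.le_metricEntropy (hμ : IsLimitMeasure ν hν μ) :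
    (((-(ν * Real.log ν) - (1 - ν) * Real.log (1 - ν)) / (4 - 3 * ν) : ℝ) : EReal)
      ≤ metricEntropy shift (μ : Measure Config) :=
  le_metricEntropy_of_affine_le shift _ emitterPartition measurable_emitterPartition _ _
    hμ.affine_le_partitionEntropy

end Limit

lemma entropy_emitters_pos {ν : ℝ} (hν : ν ∈ Set.Ioo (0 : ℝ) 1) :
    0 < (-(ν * Real.log ν) - (1 - ν) * Real.log (1 - ν)) / (4 - 3 * ν) := by
  have h1 := hν.1
  have h2 : 0 < 1 - ν := sub_pos.2 hν.2
  have h3 := mul_neg_of_pos_of_neg h1 (Real.log_neg h1 hν.2)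
  have h4 := mul_neg_of_pos_of_neg h2 (Real.log_neg h2 (by linarith))
  exact div_pos (by linarith) (by linarith)

/-- After clearing denominators the inequality reads `ν ^ 4 ≤ 1 - ν`. -/
lemma log_div_four_le_entropy_emitters {ν : ℝ} (hν : ν ∈ Set.Ioo (0 : ℝ) 1)
    (h : ν ^ 3 ≤ 1 - ν) :
    Real.log (1 / (1 - ν)) / 4
      ≤ (-(ν * Real.log ν) - (1 - ν) * Real.log (1 - ν)) / (4 - 3 * ν) := by
  have h1 := hν.1
  have h2 : 0 < 1 - ν := sub_pos.2 hν.2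
  have h3 : ν ^ 4 ≤ 1 - ν := (pow_le_pow_of_le_one h1.le hν.2.le (by norm_num)).trans h
  have h4 := Real.log_le_log (by positivity) h3
  rw [Real.log_pow] at h4
  push_cast at h4
  rw [one_div, Real.log_inv, div_le_div_iff₀ (by norm_num) (by linarith)]
  linarith [mul_le_mul_of_nonneg_left h4 h1.le]

end

theorem mainTheorem6 (ν : ℝ) (hν : ν ∈ Set.Ioo (0 : ℝ) 1) :
    (∃ μ : ProbabilityMeasure Config, IsLimitMeasure ν hν μ) ∧
    ∀ μ : ProbabilityMeasure Config, IsLimitMeasure ν hν μ →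
      MeasurePreserving shift (μ : Measure Config) (μ : Measure Config) ∧
      MeasurePreserving aut (μ : Measure Config) (μ : Measure Config) ∧
      0 < metricEntropy shift (μ : Measure Config) ∧
      (ν ^ 3 ≤ 1 - ν →
        ((Real.log (1 / (1 - ν)) / 4 : ℝ) : EReal) ≤
          metricEntropy shift (μ : Measure Config)) := by
  refine ⟨exists_isLimitMeasure ν hν, fun μ hμ => ⟨hμ.measurePreserving_shift,
    hμ.measurePreserving_aut, ?_, fun h => ?_⟩⟩
  · exact lt_of_lt_of_le (EReal.coe_pos.2 (entropy_emitters_pos hν)) hμ.le_metricEntropy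
  · exact le_trans (EReal.coe_le_coe_iff.2 (log_div_four_le_entropy_emitters hν h))
      hμ.le_metricEntropy
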